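/- Let $G$ be a finite-dimensional real analytic Moufang loop with unit $e$, i.e. a quasigroup with unit satisfying $(ag)(ha)=(a(gh))a$, whose multiplication and inversion are analytic; more generally, let $G$ be a local analytic Moufang loop: an analytic manifold with unit $e$, an analytic partial multiplication defined on an open set containing all $(e,g)$ and $(g,e)$, and an analytic inversion $g\mapsto g^{-1}$ defined near $e$, such that $eg=ge=g$, $g^{-1}(gh)=h=(hg)g^{-1}$ and $(ag)(ha)=(a(gh))a$ whenever the products are defined. For $x\in T_e(G)$ let $L_x$, $R_x$, $M_x$ be the vector fields on $G$ (infinitesimal translations) whose values at $h$ are the derivatives at $g=e$ in the direction $x$ of $g\mapsto gh$, $g\mapsto hg$ and $g\mapsto g^{-1}(hg^{-1})$ respectively. Let $[x,y]:=[R_x,R_y](e)$ be the bracket of the tangent algebra $T_e(G)$ (if $gh=g+h+a(g,h)+\dots$ in coordinates centred at $e$, then $[x,y]=a(x,y)-a(y,x)$), and define the Loos bracket by $$3\{x,y,z\}=[x,[y,z]]-[y,[x,z]]+2[[x,y],z].$$ Theorem. Put $L(x;y):=[L_x,L_y]$ (Lie bracket of vector fields). For all $x,y,z,w\in T_e(G)$,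 everywhere on $G$, $$[L(x;y),L_z]=L_{\{x,y,z\}},\qquad [L(x;y),L(z;w)]=L(\{x,y,z\};w)+L(z;\{x,y,w\}).$$ Consequently, with $\mathfrak L=\{L_x\mid x\in T_e(G)\}$ and $\mathfrak h=[\mathfrak L,\mathfrak L]$ the span of the brackets, $[\mathfrak h,\mathfrak L]\subseteq\mathfrak L$, $[\mathfrak h,\mathfrak h]\subseteq\mathfrak h$, and $\mathfrak L+[\mathfrak L,\mathfrak L]$ is closed under the Lie bracket. The same statements hold with $L$ replaced throughout by $R$, and with $L$ replaced throughout by $M$ (with the same Loos bracket). -/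

import Mathlib

open scoped Manifold ContDiff
open VectorField

noncomputable section

/-- A real analytic Moufang loop modelled on `E`: a quasigroup with unit (unique left and right
division) satisfying `(ag)(ha) = (a(gh))a`, with analytic multiplication and inversion. -/
structure AnalyticMoufangLoop (E : Type*) [NormedAddCommGroup E] [NormedSpace ℝ E]
    (G : Type*) [TopologicalSpace G] [ChartedSpace E G] where
  mul : G → G → G
  one : G
  inv : G → G
  one_mul : ∀ g, mul one g = g
  mul_one : ∀ g, mul g one = g
  existsUnique_left : ∀ a b, ∃! x, mul a x = b
  existsUnique_right : ∀ a b, ∃! y, mul y a = b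
  mul_inv : ∀ g, mul g (inv g) = one
  moufang : ∀ a g h, mul (mul a g) (mul h a) = mul (mul a (mul g h)) a
  contMDiff_mul : ContMDiff (𝓘(ℝ, E).prod 𝓘(ℝ, E)) 𝓘(ℝ, E) ω (fun p : G × G => mul p.1 p.2)
  contMDiff_inv : ContMDiff 𝓘(ℝ, E) 𝓘(ℝ, E) ω inv

/-- A local real analytic Moufang loop modelled on `E`. The multiplication `mul` is meaningful on
the open set `dom` only, which contains all pairs `(e, g)` and `(g, e)`; the inversion `inv` is
meaningful on the open set `invDom ∋ e` only. The identities hold whenever all the products in them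
are defined. For `dom = univ` and `invDom = univ` this is a (global) analytic Moufang loop, see
`AnalyticMoufangLoop.toLocal`. -/
structure LocalAnalyticMoufangLoop (E : Type*) [NormedAddCommGroup E] [NormedSpace ℝ E]
    (G : Type*) [TopologicalSpace G] [ChartedSpace E G] where
  mul : G → G → G
  one : G
  inv : G → G
  dom : Set (G × G)
  invDom : Set G
  isOpen_dom : IsOpen dom
  isOpen_invDom : IsOpen invDom
  one_left_mem : ∀ g, (one, g) ∈ dom
  one_right_mem : ∀ g, (g, one) ∈ dom
  one_mem : one ∈ invDom
  one_mul : ∀ g, mul one g = g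
  mul_one : ∀ g, mul g one = g
  inv_mul_cancel_left : ∀ g ∈ invDom, ∀ h, (g, h) ∈ dom → (inv g, mul g h) ∈ dom →
    mul (inv g) (mul g h) = h
  mul_inv_cancel_right : ∀ g ∈ invDom, ∀ h, (h, g) ∈ dom → (mul h g, inv g) ∈ dom →
    mul (mul h g) (inv g) = h
  moufang : ∀ a g h, (a, g) ∈ dom → (h, a) ∈ dom → (mul a g, mul h a) ∈ dom →
    (g, h) ∈ dom → (a, mul g h) ∈ dom → (mul a (mul g h), a) ∈ dom →
    mul (mul a g) (mul h a) = mul (mul a (mul g h)) a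
  contMDiffOn_mul : ContMDiffOn (𝓘(ℝ, E).prod 𝓘(ℝ, E)) 𝓘(ℝ, E) ω
    (fun p : G × G => mul p.1 p.2) dom
  contMDiffOn_inv : ContMDiffOn 𝓘(ℝ, E) 𝓘(ℝ, E) ω inv invDom

namespace AnalyticMoufangLoop

variable {E : Type*} [NormedAddCommGroup E] [NormedSpace ℝ E]
  {G : Type*} [TopologicalSpace G] [ChartedSpace E G] (Q : AnalyticMoufangLoop E G)

theorem left_cancel {a x y : G} (h : Q.mul a x = Q.mul a y) : x = y :=
  (Q.existsUnique_left a (Q.mul a y)).unique h rfl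

theorem right_cancel {a x y : G} (h : Q.mul x a = Q.mul y a) : x = y :=
  (Q.existsUnique_right a (Q.mul y a)).unique h rfl

theorem mul_inv_left (a h : G) : Q.mul a (Q.mul (Q.inv a) h) = h := by
  have := Q.moufang a (Q.inv a) h
  rw [Q.mul_inv, Q.one_mul] at this
  exact (Q.right_cancel this).symm

theorem inv_mul_left (a h : G) : Q.mul (Q.inv a) (Q.mul a h) = h :=
  Q.left_cancel (Q.mul_inv_left a _)

theorem flexible (a h : G) : Q.mul a (Q.mul h a) = Q.mul (Q.mul a h) a := by
  have := Q.moufang a Q.one h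
  rwa [Q.mul_one, Q.one_mul] at this

theorem inv_mul_right (a g : G) : Q.mul (Q.mul g (Q.inv a)) a = g := by
  have h1 : Q.mul (Q.inv a) a = Q.one := by
    have := Q.inv_mul_left a Q.one
    rwa [Q.mul_one] at this
  have := Q.moufang a g (Q.inv a)
  rw [h1, Q.mul_one, ← Q.flexible] at this
  exact (Q.left_cancel this).symm

theorem mul_inv_right (a g : G) : Q.mul (Q.mul g a) (Q.inv a) = g :=
  Q.right_cancel (Q.inv_mul_right a _)

/-- Every analytic Moufang loop is a local analytic Moufang loop. -/
def toLocal : LocalAnalyticMoufangLoop E G where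
  mul := Q.mul
  one := Q.one
  inv := Q.inv
  dom := Set.univ
  invDom := Set.univ
  isOpen_dom := isOpen_univ
  isOpen_invDom := isOpen_univ
  one_left_mem _ := trivial
  one_right_mem _ := trivial
  one_mem := trivial
  one_mul := Q.one_mul
  mul_one := Q.mul_one
  inv_mul_cancel_left g _ h _ _ := Q.inv_mul_left g h
  mul_inv_cancel_right g _ h _ _ := Q.mul_inv_right g h
  moufang a g h _ _ _ _ _ _ := Q.moufang a g h
  contMDiffOn_mul := Q.contMDiff_mul.contMDiffOn
  contMDiffOn_inv := Q.contMDiff_inv.contMDiffOn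

end AnalyticMoufangLoop

/-- Vector fields on the manifold `G`. -/
abbrev VField (E : Type*) [NormedAddCommGroup E] [NormedSpace ℝ E]
    (G : Type*) [TopologicalSpace G] [ChartedSpace E G] : Type _ :=
  (h : G) → TangentSpace 𝓘(ℝ, E) h

/-- The real span `[A, B]` of the Lie brackets of vector fields from `A` and from `B`. -/
def VField.bracketSpan {E : Type*} [NormedAddCommGroup E] [NormedSpace ℝ E]
    {G : Type*} [TopologicalSpace G] [ChartedSpace E G]
    (A B : Submodule ℝ (VField E G)) : Submodule ℝ (VField E G) :=
  Submodule.span ℝ {Z | ∃ X ∈ A, ∃ Y ∈ B, Z = mlieBracket 𝓘(ℝ, E) X Y}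

namespace LocalAnalyticMoufangLoop

variable {E : Type*} [NormedAddCommGroup E] [NormedSpace ℝ E]
  {G : Type*} [TopologicalSpace G] [ChartedSpace E G] (Q : LocalAnalyticMoufangLoop E G)

/-- The tangent space `T_e(G)`. -/
abbrev Tangent : Type _ := TangentSpace 𝓘(ℝ, E) Q.one

/-- The infinitesimal transformations of a family of maps `φ g : G → G` with `φ e = id`: the vector
field of `x ∈ T_e(G)` at the point `h` is the derivative at `g = e`, in the direction `x`,
of `g ↦ φ g h`. -/
def infinitesimal (φ : G → G → G) : Q.Tangent →ₗ[ℝ] VField E G where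
  toFun x h := mfderiv 𝓘(ℝ, E) 𝓘(ℝ, E) (fun g : G => φ g h) Q.one x
  map_add' x y := funext fun h =>
    map_add (mfderiv 𝓘(ℝ, E) 𝓘(ℝ, E) (fun g : G => φ g h) Q.one) x y
  map_smul' c x := funext fun h =>
    map_smul (mfderiv 𝓘(ℝ, E) 𝓘(ℝ, E) (fun g : G => φ g h) Q.one) c x

/-- `L_x`, from the left translations `h ↦ gh`. -/
def L : Q.Tangent →ₗ[ℝ] VField E G := Q.infinitesimal fun g h => Q.mul g h

/-- `R_x`, from the right translations `h ↦ hg`. -/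
def R : Q.Tangent →ₗ[ℝ] VField E G := Q.infinitesimal fun g h => Q.mul h g

/-- `M_x`, from the maps `M_g = L_g⁻¹ R_g⁻¹`, that is, `h ↦ g⁻¹(hg⁻¹)`. -/
def M : Q.Tangent →ₗ[ℝ] VField E G :=
  Q.infinitesimal fun g h => Q.mul (Q.inv g) (Q.mul h (Q.inv g))

/-- The bracket of the tangent algebra, `[x, y] = [R_x, R_y](e)`. If, in coordinates centred at
`e`, the product is `g + h + a(g, h) + …`, then this is `a(x, y) - a(y, x)`. For a Lie group it is
the usual Lie bracket on `T_e(G)`. -/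
def bracket (x y : Q.Tangent) : Q.Tangent := mlieBracket 𝓘(ℝ, E) (Q.R x) (Q.R y) Q.one

/-- The Yamaguti bracket `[x, y, z]`. -/
def yamaguti (x y z : Q.Tangent) : Q.Tangent :=
  Q.bracket x (Q.bracket y z) - Q.bracket y (Q.bracket x z) + Q.bracket (Q.bracket x y) z

/-- The Loos bracket `{x, y, z}`. -/
def loos (x y z : Q.Tangent) : Q.Tangent :=
  (3⁻¹ : ℝ) • (Q.yamaguti x y z + Q.bracket (Q.bracket x y) z)

/-- `T(x; y) = [T_x, T_y]`, for a linear family `T` of vector fields (`T = L`, `R` or `M`). -/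
def double (T : Q.Tangent →ₗ[ℝ] VField E G) (x y : Q.Tangent) : VField E G :=
  mlieBracket 𝓘(ℝ, E) (T x) (T y)

end LocalAnalyticMoufangLoop

end

/-! Call a triple `(A, B, C)` of vector fields an infinitesimal autotopism if `A ⊕ B` on `G × G` is
related to `C` by the multiplication. Brackets respect relatedness, so these triples form a Lie
algebra. Since `eg = ge = g`, such a triple satisfies `C = B + L_{A(e)}` and `C = A + R_{B(e)}`, so
an identity between triples can be read off from values at `e`.

Differentiating the Moufang identity in `a` gives the triples `(L_x, R_x, L_x + R_x)`; with the
inverse property it also gives `(-R_x, L_x + R_x, R_x)`. Comparing brackets of these triples at `e`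
yields `[R_x, R_y] = R_{[x,y]} - 2[L_x, R_y]` and `[L_x, L_y] = -L_{[x,y]} - 2[L_x, R_y]`
(`relations`). Hence each double bracket is, up to a combination of `L_{[x,y]}` and `R_{[x,y]}`, a
field `D` with `(D, D, D)` a triple, an infinitesimal automorphism (`deriv_mem`). As `D` maps
translations to translations, `[[T_x, T_y], T_z] = T_t` for `T = L`, `R` and `M = -(L + R)`, with
the same `t = [[R_x, R_y], R_z](e)` (`lie_lie`). The Jacobi identity evaluated at `e` gives `t = {x,
y, z}` (`three_smul_ev_lie_lie_right`).

The second formula and the inclusions are then the Leibniz rule for a Lie triple system. -/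

/-! ### Lie brackets of related vector fields -/

open Filter Topology in
/-- The Lie bracket of vector fields on normed spaces is compatible with `f`-relatedness. -/
theorem VectorField.fderiv_lieBracket_of_related {E F : Type*} [NormedAddCommGroup E]
    [NormedSpace ℝ E] [NormedAddCommGroup F] [NormedSpace ℝ F] {f : E → F} {x : E}
    (hf : ContDiffAt ℝ 2 f x) {V V' : E → E} {W W' : F → F}
    (hV : DifferentiableAt ℝ V x) (hV' : DifferentiableAt ℝ V' x)
    (hW : DifferentiableAt ℝ W (f x)) (hW' : DifferentiableAt ℝ W' (f x))
    (h : ∀ᶠ y in 𝓝 x, fderiv ℝ f y (V y) = W (f y))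
    (h' : ∀ᶠ y in 𝓝 x, fderiv ℝ f y (V' y) = W' (f y)) :
    fderiv ℝ f x (lieBracket ℝ V V' x) = lieBracket ℝ W W' (f x) := by
  have hfx : DifferentiableAt ℝ f x := hf.differentiableAt (by simp)
  rw [fderiv_apply_lieBracket hf (by simp) hV' hV,
    EventuallyEq.fderiv_eq (f := W ∘ f) h, EventuallyEq.fderiv_eq (f := W' ∘ f) h',
    fderiv_comp x hW hfx, fderiv_comp x hW' hfx]
  simp only [ContinuousLinearMap.comp_apply, h.self_of_nhds, h'.self_of_nhds, lieBracket]

section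

variable {E H M : Type*} [NormedAddCommGroup E] [NormedSpace ℝ E] [TopologicalSpace H]
  {I : ModelWithCorners ℝ E H} [TopologicalSpace M] [ChartedSpace H M]

theorem VectorField.mpullbackWithin_extChartAt_symm_apply [IsManifold I 1 M] (x : M)
    (V : (y : M) → TangentSpace I y) {y : E} (hy : y ∈ (extChartAt I x).target) :
    mpullbackWithin 𝓘(ℝ, E) I (extChartAt I x).symm V (Set.range I) y =
      mfderiv I 𝓘(ℝ, E) (extChartAt I x) ((extChartAt I x).symm y)
        (V ((extChartAt I x).symm y)) := by
  rw [mpullbackWithin_apply]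
  congr 1
  exact ContinuousLinearMap.inverse_eq
    (mfderivWithin_extChartAt_symm_comp_mfderiv_extChartAt hy)
    (mfderiv_extChartAt_comp_mfderivWithin_extChartAt_symm hy)

/-- The bracket is computed in the chart at `x` and carried back by the differential of that chart
at its own base point, which is the identity. -/
theorem VectorField.mlieBracket_eq_lieBracket [IsManifold I 1 M] [I.Boundaryless] (x : M)
    (V W : (y : M) → TangentSpace I y) :
    (mlieBracket I V W x : E) = lieBracket ℝ
      (mpullbackWithin 𝓘(ℝ, E) I (extChartAt I x).symm V (Set.range I))
      (mpullbackWithin 𝓘(ℝ, E) I (extChartAt I x).symm W (Set.range I)) (extChartAt I x x) := by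
  rw [← mlieBracketWithin_univ, mlieBracketWithin_apply, mfderiv_extChartAt_self]
  simp only [Set.preimage_univ, I.range_eq_univ, Set.inter_univ]
  erw [ContinuousLinearMap.inverse_id]
  exact congrFun (lieBracketWithin_univ (𝕜 := ℝ) (E := E)) _

/-- A differentiable vector field is differentiable in a chart. -/
theorem MDifferentiableAt.differentiableAt_mpullbackWithin_extChartAt [CompleteSpace E]
    [IsManifold I 2 M] [I.Boundaryless] {V : (y : M) → TangentSpace I y} {x : M}
    (hV : MDifferentiableAt I I.tangent (fun y => (V y : TangentBundle I M)) x) :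
    DifferentiableAt ℝ (mpullbackWithin 𝓘(ℝ, E) I (extChartAt I x).symm V (Set.range I))
      (extChartAt I x x) := by
  have := (hV.mdifferentiableWithinAt (s := Set.univ)
    |>.differentiableWithinAt_mpullbackWithin_vectorField)
  rw [Set.preimage_univ, Set.univ_inter] at this
  exact this.differentiableAt (by rw [I.range_eq_univ]; exact Filter.univ_mem)

variable {F H' N : Type*} [NormedAddCommGroup F] [NormedSpace ℝ F] [TopologicalSpace H']
  {J : ModelWithCorners ℝ F H'} [TopologicalSpace N] [ChartedSpace H' N]

open Filter Topology in
/-- The Lie bracket of vector fields on manifolds is compatible with `f`-relatedness. -/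
theorem VectorField.mfderiv_mlieBracket_of_related [CompleteSpace E] [CompleteSpace F]
    [IsManifold I 2 M] [IsManifold J 2 N] [I.Boundaryless] [J.Boundaryless] {f : M → N} {x : M}
    (hf : ContMDiffAt I J 2 f x) {V V' : (y : M) → TangentSpace I y}
    {W W' : (y : N) → TangentSpace J y}
    (hV : MDifferentiableAt I I.tangent (fun y => (V y : TangentBundle I M)) x)
    (hV' : MDifferentiableAt I I.tangent (fun y => (V' y : TangentBundle I M)) x)
    (hW : MDifferentiableAt J J.tangent (fun y => (W y : TangentBundle J N)) (f x))
    (hW' : MDifferentiableAt J J.tangent (fun y => (W' y : TangentBundle J N)) (f x))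
    (h : ∀ᶠ y in 𝓝 x, mfderiv I J f y (V y) = W (f y))
    (h' : ∀ᶠ y in 𝓝 x, mfderiv I J f y (V' y) = W' (f y)) :
    mfderiv I J f x (mlieBracket I V V' x) = mlieBracket J W W' (f x) := by
  have : IsManifold I 1 M := IsManifold.of_le (n := 2) (by norm_num)
  have : IsManifold J 1 N := IsManifold.of_le (n := 2) (by norm_num)
  have hfx : MDifferentiableAt I J f x := hf.mdifferentiableAt (by simp)
  have hfhat : ContDiffAt ℝ 2 (writtenInExtChartAt I J x f) (extChartAt I x x) := by
    have := (contMDiffAt_iff.1 hf).2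
    rwa [I.range_eq_univ, contDiffWithinAt_univ] at this
  have hval : writtenInExtChartAt I J x f (extChartAt I x x) = extChartAt J (f x) (f x) := by
    simp [writtenInExtChartAt]
  have key {V : (y : M) → TangentSpace I y} {W : (y : N) → TangentSpace J y}
      (h : ∀ᶠ y in 𝓝 x, mfderiv I J f y (V y) = W (f y)) :
      ∀ᶠ y in 𝓝 (extChartAt I x x), fderiv ℝ (writtenInExtChartAt I J x f) y
        (mpullbackWithin 𝓘(ℝ, E) I (extChartAt I x).symm V (Set.range I) y) =
        mpullbackWithin 𝓘(ℝ, F) J (extChartAt J (f x)).symm W (Set.range J)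
          (writtenInExtChartAt I J x f y) := by
    have hsrc : ∀ᶠ y in 𝓝 x, f y ∈ (extChartAt J (f x)).source :=
      hf.continuousAt.preimage_mem_nhds (extChartAt_source_mem_nhds (f x))
    have hd : ∀ᶠ y in 𝓝 x, MDifferentiableAt I J f y := by
      filter_upwards [(contMDiffAt_iff_contMDiffAt_nhds (by simp)).1 hf] with y hy using hy.mdifferentiableAt (by simp)
    have ht : Tendsto (extChartAt I x).symm (𝓝 (extChartAt I x x)) (𝓝 x) := by
      have := (continuousAt_extChartAt_symm (I := I) x).tendsto
      rwa [extChartAt_to_inv] at this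
    filter_upwards [ht.eventually h, ht.eventually hsrc, ht.eventually hd,
      extChartAt_target_mem_nhds (I := I) x] with y hy hys hyd hyt
    set p := (extChartAt I x).symm y with hp
    have hlin : (extChartAt J (f x)).symm (writtenInExtChartAt I J x f y) = f p :=
      (extChartAt J (f x)).left_inv hys
    have e1 := mpullbackWithin_extChartAt_symm_apply x V hyt
    have e2 := mpullbackWithin_extChartAt_symm_apply (f x) W
      (y := writtenInExtChartAt I J x f y) ((extChartAt J (f x)).map_source hys)
    rw [hlin, ← hy] at e2
    refine Eq.trans ?_ e2.symm
    have hc : fderiv ℝ (writtenInExtChartAt I J x f) y =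
        (mfderiv J 𝓘(ℝ, F) (extChartAt J (f x)) (f p)).comp
          ((mfderiv I J f p).comp (mfderiv 𝓘(ℝ, E) I (extChartAt I x).symm y)) := by
      have hs : MDifferentiableAt 𝓘(ℝ, E) I (extChartAt I x).symm y := by
        have := mdifferentiableWithinAt_extChartAt_symm (I := I) hyt
        rwa [I.range_eq_univ, mdifferentiableWithinAt_univ] at this
      have hχ : MDifferentiableAt J 𝓘(ℝ, F) (extChartAt J (f x)) (f p) :=
        mdifferentiableAt_extChartAt (by rwa [extChartAt_source] at hys)
      rw [← mfderiv_eq_fderiv]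
      exact ((hχ.hasMFDerivAt.comp y (hyd.hasMFDerivAt.comp y hs.hasMFDerivAt))).mfderiv
    rw [hc]
    refine congrArg (fun v => mfderiv J 𝓘(ℝ, F) (extChartAt J (f x)) (f p) (mfderiv I J f p v)) ?_
    have := DFunLike.congr_fun
      (mfderivWithin_extChartAt_symm_comp_mfderiv_extChartAt hyt) (V p)
    rw [I.range_eq_univ, mfderivWithin_univ] at this
    rw [e1]
    exact this
  have main := fderiv_lieBracket_of_related hfhat (MDifferentiableAt.differentiableAt_mpullbackWithin_extChartAt hV) (MDifferentiableAt.differentiableAt_mpullbackWithin_extChartAt hV')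
    (by rw [hval]; exact MDifferentiableAt.differentiableAt_mpullbackWithin_extChartAt hW) (by rw [hval]; exact MDifferentiableAt.differentiableAt_mpullbackWithin_extChartAt hW') (key h) (key h')
  rw [hval] at main
  have e1 := mlieBracket_eq_lieBracket x V V'
  have e2 := mlieBracket_eq_lieBracket (f x) W W'
  let D : E →L[ℝ] F := mfderiv I J f x
  have hd : HasFDerivWithinAt (writtenInExtChartAt I J x f) D (Set.range I) (extChartAt I x x) :=
    hfx.hasMFDerivAt.2
  rw [I.range_eq_univ, hasFDerivWithinAt_univ] at hd
  rw [hd.fderiv, ← e1] at main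
  exact main.trans e2.symm

end

/-! ### Lie algebra of infinitesimal autotopisms -/

section

variable {V X : Type*} [AddCommGroup V] [Module ℝ V] [LieRing X] [LieAlgebra ℝ X]

/-- The infinitesimal form of the autotopisms of a Moufang loop: `L x` and `R x` are the
infinitesimal translations, `ev` is evaluation at the unit, and the triples of `A₁` and of `A₂` are
the vector fields `(a, b, c)` with `c(gh) = a(g)h + g b(h)` for `(g, h)` in two neighbourhoods,
of `{e} × G ∪ G × {e}` and of `{e} × G`. -/
structure InfinitesimalMoufang (L R : V →ₗ[ℝ] X) (ev : X →ₗ[ℝ] V)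
    (A₁ A₂ : Submodule ℝ (X × X × X)) : Prop where
  ev_left : ∀ x, ev (L x) = x
  ev_right : ∀ x, ev (R x) = x
  lie_mem₁ : ∀ p ∈ A₁, ∀ q ∈ A₁, (⁅p.1, q.1⁆, ⁅p.2.1, q.2.1⁆, ⁅p.2.2, q.2.2⁆) ∈ A₁
  lie_mem₂ : ∀ p ∈ A₂, ∀ q ∈ A₂, (⁅p.1, q.1⁆, ⁅p.2.1, q.2.1⁆, ⁅p.2.2, q.2.2⁆) ∈ A₂
  middle_mem₁ : ∀ x, (L x, R x, L x + R x) ∈ A₁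
  middle_mem₂ : ∀ x, (L x, R x, L x + R x) ∈ A₂
  right_mem₂ : ∀ x, (-R x, L x + R x, R x) ∈ A₂
  eq_right₁ : ∀ p ∈ A₁, p.2.2 = p.1 + R (ev p.2.1)
  eq_left₁ : ∀ p ∈ A₁, p.2.2 = p.2.1 + L (ev p.1)
  eq_left₂ : ∀ p ∈ A₂, p.2.2 = p.2.1 + L (ev p.1)

namespace InfinitesimalMoufang

variable {L R : V →ₗ[ℝ] X} {ev : X →ₗ[ℝ] V} {A₁ A₂ : Submodule ℝ (X × X × X)}
  (h : InfinitesimalMoufang L R ev A₁ A₂)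

include h

theorem left_mem₂ (x : V) : (L x + R x, -L x, L x) ∈ A₂ := by
  simpa using A₂.sub_mem (h.middle_mem₂ x) (h.right_mem₂ x)

/-- Three brackets of triples suffice: right with right, middle with middle, left with right. Their
values at `e` force `3 [L_x, R_y](e) = 0`; the fields are then determined by linear algebra. -/
theorem relations (x y : V) :
    ⁅R x, R y⁆ = R (ev ⁅R x, R y⁆) - (2 : ℝ) • ⁅L x, R y⁆ ∧
    ⁅L x, L y⁆ = -L (ev ⁅R x, R y⁆) - (2 : ℝ) • ⁅L x, R y⁆ ∧ ev ⁅L x, R y⁆ = 0 := by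
  have h1 := h.eq_left₂ _ (h.lie_mem₂ _ (h.right_mem₂ x) _ (h.right_mem₂ y))
  have h2 := h.eq_right₁ _ (h.lie_mem₁ _ (h.middle_mem₁ x) _ (h.middle_mem₁ y))
  have h3 := h.eq_left₂ _ (h.lie_mem₂ _ (h.left_mem₂ x) _ (h.right_mem₂ y))
  simp only [lie_add, add_lie, neg_lie, lie_neg, neg_neg, map_add, map_neg] at h1 h2 h3
  have e1 := congrArg ev h1
  have e2 := congrArg ev h2
  have e3 := congrArg ev h3
  simp only [map_add, map_neg, h.ev_left, h.ev_right] at e1 e2 e3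
  have hLL : ev ⁅L x, L y⁆ = -ev ⁅R x, R y⁆ := by
    linear_combination (norm := module) -e1 - e2
  have hP : ev ⁅L x, R y⁆ = 0 := by
    rw [hLL] at e3
    linear_combination (norm := module) (1 / 3 : ℝ) • e3
  rw [hP] at h3
  simp only [map_zero] at h3
  refine ⟨?_, ?_, hP⟩
  · linear_combination (norm := module) h1 + h2 + h3
  · linear_combination (norm := module) h3

theorem lie_right_right (x y : V) :
    ⁅R x, R y⁆ = R (ev ⁅R x, R y⁆) - (2 : ℝ) • ⁅L x, R y⁆ := (h.relations x y).1

theorem lie_left_left (x y : V) :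
    ⁅L x, L y⁆ = -L (ev ⁅R x, R y⁆) - (2 : ℝ) • ⁅L x, R y⁆ := (h.relations x y).2.1

theorem ev_lie_left_right (x y : V) : ev ⁅L x, R y⁆ = 0 := (h.relations x y).2.2

/-- By `lie_right_right`, `[L_x, R_y]` is a combination of terms antisymmetric in `x` and `y`. -/
theorem lie_left_right_symm (x y : V) : ⁅R x, L y⁆ = ⁅L x, R y⁆ := by
  have h1 := h.lie_right_right x y
  have h2 := h.lie_right_right y x
  rw [← lie_skew (R y) (R x), map_neg, map_neg] at h2
  rw [← lie_skew (R x) (L y)]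
  linear_combination (norm := module) (-1 / 2 : ℝ) • (h1 + h2)

omit h in
variable (L R ev) in
/-- The derivation of the tangent algebra attached to two tangent vectors. -/
noncomputable def deriv (x y : V) : X :=
  ⁅R x, R y⁆ - (2 / 3 : ℝ) • L (ev ⁅R x, R y⁆) - (1 / 3 : ℝ) • R (ev ⁅R x, R y⁆)

/-- The coefficients `2/3` and `1/3` are those for which subtracting the left and right triples of
`[x, y]` from the bracket of two right triples makes all three components coincide. -/
theorem deriv_mem (x y : V) : (deriv L R ev x y, deriv L R ev x y, deriv L R ev x y) ∈ A₂ := by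
  have h1 := h.lie_mem₂ _ (h.right_mem₂ x) _ (h.right_mem₂ y)
  have h2 := A₂.smul_mem (2 / 3 : ℝ) (h.left_mem₂ (ev ⁅R x, R y⁆))
  have h3 := A₂.smul_mem (1 / 3 : ℝ) (h.right_mem₂ (ev ⁅R x, R y⁆))
  convert A₂.sub_mem (A₂.sub_mem h1 h2) h3 using 1
  have e1 := h.lie_right_right x y
  have e2 := h.lie_left_left x y
  simp only [Prod.smul_mk, Prod.mk_sub_mk, Prod.mk.injEq, deriv, lie_add, add_lie, neg_lie, lie_neg,
    neg_neg, h.lie_left_right_symm]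
  refine ⟨?_, ?_, trivial⟩
  · module
  · linear_combination (norm := module) -e2

/-- Bracket the triple `(D, D, D)` with the right triple of `z` and compare with `eq_left₂`. The
analogue for `R` is not available in this way, because `A₂` has no rule at `G × {e}`. -/
theorem lie_deriv_left (x y z : V) :
    ⁅deriv L R ev x y, L z⁆ = L (ev ⁅deriv L R ev x y, R z⁆) := by
  have h1 := h.eq_left₂ _ (h.lie_mem₂ _ (h.deriv_mem x y) _ (h.right_mem₂ z))
  simp only [lie_add, lie_neg, map_neg] at h1
  linear_combination (norm := module) -h1

theorem lie_lie_right (x y z : V) :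
    ⁅⁅R x, R y⁆, R z⁆ = ⁅deriv L R ev x y, R z⁆ + (1 / 3 : ℝ) • R (ev ⁅R (ev ⁅R x, R y⁆), R z⁆) := by
  have h1 := h.lie_right_right (ev ⁅R x, R y⁆) z
  simp only [deriv, sub_lie, smul_lie]
  linear_combination (norm := module) (1 / 3 : ℝ) • h1

/-- Both `[L_x, L_y]` and `[R_x, R_y]` equal `D` plus a combination of `L_{[x,y]}` and `R_{[x,y]}`.
Bracketing with a translation and applying the basic relations leaves the same correction, one third
of the translation by `[[x, y], z]`. -/
theorem lie_lie_left (x y z : V) :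
    ⁅⁅L x, L y⁆, L z⁆ = L (ev ⁅⁅R x, R y⁆, R z⁆) := by
  have h1 := h.lie_left_left (ev ⁅R x, R y⁆) z
  have h2 := h.lie_left_left x y
  have h3 := h.lie_right_right x y
  have h4 := h.lie_deriv_left x y z
  rw [h.lie_lie_right, map_add, map_add, ← h4, map_smul, h.ev_right, map_smul]
  have e : ⁅L x, L y⁆ = deriv L R ev x y - (2 / 3 : ℝ) • R (ev ⁅R x, R y⁆)
      - (1 / 3 : ℝ) • L (ev ⁅R x, R y⁆) := by
    simp only [deriv]
    linear_combination (norm := module) h2 - h3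
  rw [e]
  simp only [sub_lie, smul_lie, h.lie_left_right_symm]
  linear_combination (norm := module) (-1 / 3 : ℝ) • h1

/-- The iterated bracket of middle triples, minus a suitable middle triple, has first component zero
by `lie_lie_left` and second component zero at `e`. The two rules for `A₁` then force the second
component to vanish identically. -/
theorem lie_lie_right_eq (x y z : V) :
    ⁅⁅R x, R y⁆, R z⁆ = R (ev ⁅⁅R x, R y⁆, R z⁆) := by
  have h1 := A₁.sub_mem (h.lie_mem₁ _ (h.lie_mem₁ _ (h.middle_mem₁ x) _ (h.middle_mem₁ y)) _
    (h.middle_mem₁ z)) (h.middle_mem₁ (ev ⁅⁅R x, R y⁆, R z⁆))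
  have h2 := h.eq_right₁ _ h1
  have h3 := h.eq_left₁ _ h1
  simp only [Prod.mk_sub_mk, h.lie_lie_left, sub_self, map_zero, map_sub, h.ev_right] at h2 h3
  linear_combination (norm := module) h2 - h3

theorem lie_deriv_right (x y z : V) :
    ⁅deriv L R ev x y, R z⁆ = R (ev ⁅deriv L R ev x y, R z⁆) := by
  have h1 := h.lie_lie_right x y z
  rw [h.lie_lie_right_eq] at h1
  have h2 := congrArg ev h1
  simp only [map_add, map_smul, h.ev_right] at h2
  rw [h2] at h1
  simp only [map_add, map_smul] at h1
  linear_combination (norm := module) -h1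

/-- Write `t(x,y,z)` for `[[R_x, R_y], R_z](e)`. The Leibniz rule for `[L_z, [R_x, R_y]]`, with `[L,
R]` eliminated, expresses `t(x,y,z)` by brackets and by `t(z,y,x) - t(z,x,y)`. The Jacobi identity
for `R_x, R_y, R_z` turns that difference into `t(x,y,z)`, whence the factor 3. -/
theorem three_smul_ev_lie_lie_right (x y z : V) :
    (3 : ℝ) • ev ⁅⁅R x, R y⁆, R z⁆ = ev ⁅R x, R (ev ⁅R y, R z⁆)⁆ - ev ⁅R y, R (ev ⁅R x, R z⁆)⁆ +
      (2 : ℝ) • ev ⁅R (ev ⁅R x, R y⁆), R z⁆ := by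
  have skew (a b : X) : ev ⁅a, b⁆ = -ev ⁅b, a⁆ := by rw [← lie_skew, map_neg]
  have hP (x y z : V) : ev ⁅⁅L x, R y⁆, R z⁆ =
      (1 / 2 : ℝ) • (ev ⁅R (ev ⁅R x, R y⁆), R z⁆ - ev ⁅⁅R x, R y⁆, R z⁆) := by
    have e : ⁅L x, R y⁆ = (1 / 2 : ℝ) • (R (ev ⁅R x, R y⁆) - ⁅R x, R y⁆) := by
      have := h.lie_right_right x y
      linear_combination (norm := module) (1 / 2 : ℝ) • this
    rw [e]
    simp only [smul_lie, sub_lie, map_smul, map_sub]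
  -- Here the fact that `D` sends left translations to left translations enters.
  have hD : ev ⁅L z, ⁅R x, R y⁆⁆ = -ev ⁅⁅R x, R y⁆, R z⁆ +
      ev ⁅R (ev ⁅R x, R y⁆), R z⁆ := by
    have e1 := congrArg ev (h.lie_deriv_left x y z)
    have e2 := congrArg ev (h.lie_left_left (ev ⁅R x, R y⁆) z)
    simp only [deriv, sub_lie, smul_lie, map_sub, map_smul, map_neg, h.ev_left,
      h.lie_left_right_symm, h.ev_lie_left_right] at e1 e2
    rw [skew]
    linear_combination (norm := module) -e1 - (2 / 3 : ℝ) • e2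
  have hJ := congrArg ev (leibniz_lie (L z) (R x) (R y))
  have hC := congrArg ev (lie_jacobi (R x) (R y) (R z))
  rw [map_add, hD, hP, skew (R x) ⁅L z, R y⁆, hP] at hJ
  simp only [map_add, map_zero] at hC
  rw [skew (R x) ⁅_, _⁆, skew (R y) ⁅_, _⁆, skew (R z) ⁅_, _⁆] at hC
  have a2 : ev ⁅R x, R (ev ⁅R y, R z⁆)⁆ = ev ⁅R (ev ⁅R z, R y⁆), R x⁆ := by
    rw [skew, skew (R z) (R y), map_neg, neg_lie, map_neg]
  have a3 : ev ⁅R y, R (ev ⁅R x, R z⁆)⁆ = ev ⁅R (ev ⁅R z, R x⁆), R y⁆ := by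
    rw [skew, skew (R z) (R x), map_neg, neg_lie, map_neg]
  have a4 : ev ⁅⁅R y, R z⁆, R x⁆ = -ev ⁅⁅R z, R y⁆, R x⁆ := by
    rw [← lie_skew (R y) (R z), neg_lie, map_neg]
  rw [a2, a3]
  rw [a4] at hC
  linear_combination (norm := module) (-2 : ℝ) • hJ - hC

/-- Here the correction to `D` is a third of `R_{[x,y]} - L_{[x,y]}`; the terms `[L, R]` cancel in
its bracket with `L_z + R_z`. -/
theorem lie_lie_add (x y z : V) :
    ⁅⁅L x + R x, L y + R y⁆, L z + R z⁆ =
      L (ev ⁅⁅R x, R y⁆, R z⁆) + R (ev ⁅⁅R x, R y⁆, R z⁆) := by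
  have e : ⁅L x + R x, L y + R y⁆ = deriv L R ev x y +
      (1 / 3 : ℝ) • (R (ev ⁅R x, R y⁆) - L (ev ⁅R x, R y⁆)) := by
    have h1 := h.lie_right_right x y
    have h2 := h.lie_left_left x y
    simp only [deriv, lie_add, add_lie, h.lie_left_right_symm]
    linear_combination (norm := module) h2
  have h1 := h.lie_right_right (ev ⁅R x, R y⁆) z
  have h2 := h.lie_left_left (ev ⁅R x, R y⁆) z
  rw [e, h.lie_lie_right, map_add, map_add, map_add, map_smul, h.ev_right, ← h.lie_deriv_left,
    ← h.lie_deriv_right, map_smul, map_smul]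
  simp only [lie_add, add_lie, smul_lie, sub_lie, h.lie_left_right_symm]
  linear_combination (norm := module) (1 / 3 : ℝ) • (h1 - h2)

theorem lie_lie {T : V →ₗ[ℝ] X} (hT : T = L ∨ T = R ∨ T = -(L + R)) (x y z : V) :
    ⁅⁅T x, T y⁆, T z⁆ = T (ev ⁅⁅R x, R y⁆, R z⁆) := by
  rcases hT with rfl | rfl | rfl
  · exact h.lie_lie_left x y z
  · exact h.lie_lie_right_eq x y z
  · have := h.lie_lie_add x y z
    simp only [LinearMap.neg_apply, LinearMap.add_apply, neg_lie, lie_neg, neg_neg, neg_inj]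
    exact this

end InfinitesimalMoufang

/-! ### Lie triple systems in a Lie algebra -/

/-- The span of the brackets of elements of two subspaces of a Lie algebra. -/
def Submodule.lieSpan (A B : Submodule ℝ X) : Submodule ℝ X :=
  Submodule.span ℝ {Z | ∃ a ∈ A, ∃ b ∈ B, Z = ⁅a, b⁆}

namespace Submodule

theorem lie_mem_lieSpan {A B : Submodule ℝ X} {a b : X} (ha : a ∈ A) (hb : b ∈ B) :
    ⁅a, b⁆ ∈ lieSpan A B :=
  subset_span ⟨a, ha, b, hb, rfl⟩

theorem lieSpan_le {A B C : Submodule ℝ X} :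
    lieSpan A B ≤ C ↔ ∀ a ∈ A, ∀ b ∈ B, ⁅a, b⁆ ∈ C := by
  refine ⟨fun h a ha b hb => h (lie_mem_lieSpan ha hb), fun h => span_le.2 ?_⟩
  rintro _ ⟨a, ha, b, hb, rfl⟩
  exact h a ha b hb

variable {A : Submodule ℝ X} (hA : ∀ a ∈ A, ∀ b ∈ A, ∀ c ∈ A, ⁅⁅a, b⁆, c⁆ ∈ A)

include hA

/-- For a Lie triple system `A` in a Lie algebra, `[[A, A], A] ⊆ A`. -/
theorem lieSpan_lieSpan_self_le : lieSpan (lieSpan A A) A ≤ A := by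
  refine lieSpan_le.2 fun a ha b hb => ?_
  induction ha using span_induction with
  | mem a h =>
    obtain ⟨c, hc, d, hd, rfl⟩ := h
    exact hA c hc d hd b hb
  | zero => simp
  | add a c _ _ h1 h2 => rw [add_lie]; exact add_mem h1 h2
  | smul r a _ h => rw [smul_lie]; exact smul_mem _ r h

/-- Elements of `[A, A]` act on `A`, hence by the Leibniz rule on brackets of elements of `A`. -/
theorem lieSpan_lieSpan_lieSpan_le : lieSpan (lieSpan A A) (lieSpan A A) ≤ lieSpan A A := by
  refine lieSpan_le.2 fun a ha b hb => ?_
  have h := lieSpan_le.1 (lieSpan_lieSpan_self_le hA)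
  induction hb using span_induction with
  | mem b hb =>
    obtain ⟨c, hc, d, hd, rfl⟩ := hb
    rw [leibniz_lie]
    exact add_mem (lie_mem_lieSpan (h a ha c hc) hd) (lie_mem_lieSpan hc (h a ha d hd))
  | zero => simp
  | add b c _ _ h1 h2 => rw [lie_add]; exact add_mem h1 h2
  | smul r b _ h => rw [lie_smul]; exact smul_mem _ r h

theorem lieSpan_sup_le : lieSpan (A ⊔ lieSpan A A) (A ⊔ lieSpan A A) ≤ A ⊔ lieSpan A A := by
  refine lieSpan_le.2 fun a ha b hb => ?_
  have h := lieSpan_le.1 (lieSpan_lieSpan_self_le hA)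
  obtain ⟨a₁, ha₁, a₂, ha₂, rfl⟩ := mem_sup.1 ha
  obtain ⟨b₁, hb₁, b₂, hb₂, rfl⟩ := mem_sup.1 hb
  simp only [add_lie, lie_add]
  refine add_mem (add_mem ?_ ?_) (add_mem ?_ ?_)
  · exact mem_sup_right (lie_mem_lieSpan ha₁ hb₁)
  · exact mem_sup_left (h _ ha₂ _ hb₁)
  · rw [← lie_skew]
    exact mem_sup_left (neg_mem (h _ hb₂ _ ha₁))
  · exact mem_sup_right (lieSpan_le.1 (lieSpan_lieSpan_lieSpan_le hA) _ ha₂ _ hb₂)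

end Submodule

end

/-! ### Smooth vector fields and autotopisms -/

section

variable {E : Type*} [NormedAddCommGroup E] [NormedSpace ℝ E]
  {G : Type*} [TopologicalSpace G] [ChartedSpace E G] [IsManifold 𝓘(ℝ, E) ω G]

variable (E G) in
/-- The space of smooth vector fields on a manifold. -/
def smoothVField : Submodule ℝ (VField E G) where
  carrier := {X | ContMDiff 𝓘(ℝ, E) 𝓘(ℝ, E).tangent ∞ (fun h => (X h : TangentBundle 𝓘(ℝ, E) G))}
  zero_mem' := Bundle.contMDiff_zeroSection ℝ (TangentSpace 𝓘(ℝ, E) (M := G))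
  add_mem' hX hY := hX.add_section hY
  smul_mem' _ _ hX := hX.const_smul_section

namespace smoothVField

theorem mdifferentiableAt (X : smoothVField E G) (g : G) : MDifferentiableAt 𝓘(ℝ, E)
    𝓘(ℝ, E).tangent (fun h => (X.1 h : TangentBundle 𝓘(ℝ, E) G)) g :=
  X.2.mdifferentiable (by simp) g

variable [CompleteSpace E]

theorem mlieBracket_mem {X Y : VField E G} (hX : X ∈ smoothVField E G)
    (hY : Y ∈ smoothVField E G) : mlieBracket 𝓘(ℝ, E) X Y ∈ smoothVField E G := by
  have : IsManifold 𝓘(ℝ, E) ((⊤ : ℕ∞) + 1) G := IsManifold.of_le (n := ω) le_top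
  exact ContDiff.mlieBracket_vectorField (m := ⊤) (n := ⊤) hX hY (by simp)

noncomputable instance : Bracket (smoothVField E G) (smoothVField E G) where
  bracket X Y := ⟨mlieBracket 𝓘(ℝ, E) X.1 Y.1, mlieBracket_mem X.2 Y.2⟩

/-- Additivity and the Jacobi identity need regularity of the fields, so the Lie algebra consists of
smooth fields only. -/
noncomputable instance : LieRing (smoothVField E G) where
  add_lie X Y Z := by
    have : IsManifold 𝓘(ℝ, E) 2 G := IsManifold.of_le (n := ω) le_top
    ext g
    exact mlieBracket_add_left (smoothVField.mdifferentiableAt X g) (smoothVField.mdifferentiableAt Y g)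
  lie_add X Y Z := by
    have : IsManifold 𝓘(ℝ, E) 2 G := IsManifold.of_le (n := ω) le_top
    ext g
    exact mlieBracket_add_right (smoothVField.mdifferentiableAt Y g) (smoothVField.mdifferentiableAt Z g)
  lie_self X := Subtype.ext mlieBracket_self
  leibniz_lie X Y Z := by
    have : IsManifold 𝓘(ℝ, E) (minSmoothness ℝ 3) G := IsManifold.of_le (n := ω) le_top
    have h2 : minSmoothness ℝ 2 ≤ ∞ := by
      rw [minSmoothness_of_isRCLikeNormedField]
      exact ENat.LEInfty.out
    refine Subtype.ext (leibniz_identity_mlieBracket ?_ ?_ ?_)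
    exacts [X.2.of_le h2, Y.2.of_le h2, Z.2.of_le h2]

noncomputable instance : LieAlgebra ℝ (smoothVField E G) where
  lie_smul c X Y := by
    have : IsManifold 𝓘(ℝ, E) 2 G := IsManifold.of_le (n := ω) le_top
    ext g
    exact mlieBracket_const_smul_right (smoothVField.mdifferentiableAt Y g)

theorem map_lieSpan (A B : Submodule ℝ (smoothVField E G)) :
    (A.lieSpan B).map (smoothVField E G).subtype =
      VField.bracketSpan (A.map (smoothVField E G).subtype)
        (B.map (smoothVField E G).subtype) := by
  rw [Submodule.lieSpan, Submodule.map_span, VField.bracketSpan]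
  congr 1
  ext Z
  constructor
  · rintro ⟨_, ⟨X, hX, Y, hY, rfl⟩, rfl⟩
    exact ⟨X.1, ⟨X, hX, rfl⟩, Y.1, ⟨Y, hY, rfl⟩, rfl⟩
  · rintro ⟨_, ⟨X, hX, rfl⟩, _, ⟨Y, hY, rfl⟩, rfl⟩
    exact ⟨⁅X, Y⁆, ⟨X, hX, Y, hY, rfl⟩, rfl⟩

end smoothVField

/-- The vector field on `G × G` with the given components. -/
def VField.prod (A B : VField E G) (q : G × G) : TangentSpace (𝓘(ℝ, E).prod 𝓘(ℝ, E)) q :=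
  (A q.1, B q.2)

namespace smoothVField

theorem contMDiff_prod (A B : smoothVField E G) :
    ContMDiff (𝓘(ℝ, E).prod 𝓘(ℝ, E)) (𝓘(ℝ, E).prod 𝓘(ℝ, E)).tangent ∞
      (fun q : G × G => (VField.prod A.1 B.1 q :
        TangentBundle (𝓘(ℝ, E).prod 𝓘(ℝ, E)) (G × G))) :=
  contMDiff_equivTangentBundleProd_symm.comp
    ((A.2.comp contMDiff_fst).prodMk (B.2.comp contMDiff_snd))

variable [CompleteSpace E]

/-- Product fields are related to their components by the two projections, so naturality of the
bracket gives each component. -/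
theorem mlieBracket_prod (A B A' B' : smoothVField E G) (q : G × G) :
    mlieBracket (𝓘(ℝ, E).prod 𝓘(ℝ, E)) (VField.prod A.1 B.1) (VField.prod A'.1 B'.1) q =
      VField.prod ⁅A, A'⁆.1 ⁅B, B'⁆.1 q := by
  have : IsManifold 𝓘(ℝ, E) 2 G := IsManifold.of_le (n := ω) le_top
  have h1 := mfderiv_mlieBracket_of_related (x := q) (contMDiffAt_fst (n := 2))
    ((contMDiff_prod A B).mdifferentiable (by simp) q)
    ((contMDiff_prod A' B').mdifferentiable (by simp) q)
    (smoothVField.mdifferentiableAt A q.1) (smoothVField.mdifferentiableAt A' q.1)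
    (.of_forall fun y => by rw [mfderiv_fst]; rfl) (.of_forall fun y => by rw [mfderiv_fst]; rfl)
  have h2 := mfderiv_mlieBracket_of_related (x := q) (contMDiffAt_snd (n := 2))
    ((contMDiff_prod A B).mdifferentiable (by simp) q)
    ((contMDiff_prod A' B').mdifferentiable (by simp) q)
    (smoothVField.mdifferentiableAt B q.2) (smoothVField.mdifferentiableAt B' q.2)
    (.of_forall fun y => by rw [mfderiv_snd]; rfl) (.of_forall fun y => by rw [mfderiv_snd]; rfl)
  rw [mfderiv_fst] at h1
  rw [mfderiv_snd] at h2
  exact Prod.ext h1 h2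

omit [CompleteSpace E] in
/-- The triples `(A, B, C)` of vector fields such that `A ⊕ B` is related to `C` under the
multiplication `f`, on the set `U`. -/
def autotopism (f : G × G → G) (U : Set (G × G)) :
    Submodule ℝ (smoothVField E G × smoothVField E G × smoothVField E G) where
  carrier := {p | ∀ q ∈ U, mfderiv (𝓘(ℝ, E).prod 𝓘(ℝ, E)) 𝓘(ℝ, E) f q
    (VField.prod p.1.1 p.2.1.1 q) = p.2.2.1 (f q)}
  zero_mem' _ _ := map_zero _
  add_mem' hp hp' q hq := (map_add _ _ _).trans (congrArg₂ (· + ·) (hp q hq) (hp' q hq))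
  smul_mem' c _ hp q hq := (map_smul _ c _).trans (congrArg (c • ·) (hp q hq))

theorem lie_mem_autotopism {f : G × G → G} {U : Set (G × G)} (hU : IsOpen U)
    (hf : ContMDiffOn (𝓘(ℝ, E).prod 𝓘(ℝ, E)) 𝓘(ℝ, E) 2 f U)
    {p p' : smoothVField E G × smoothVField E G × smoothVField E G}
    (hp : p ∈ autotopism f U) (hp' : p' ∈ autotopism f U) :
    (⁅p.1, p'.1⁆, ⁅p.2.1, p'.2.1⁆, ⁅p.2.2, p'.2.2⁆) ∈ autotopism f U := by
  intro q hq
  have : IsManifold 𝓘(ℝ, E) 2 G := IsManifold.of_le (n := ω) le_top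
  have h := mfderiv_mlieBracket_of_related (x := q) (hf.contMDiffAt (hU.mem_nhds hq))
    ((contMDiff_prod p.1 p.2.1).mdifferentiable (by simp) q)
    ((contMDiff_prod p'.1 p'.2.1).mdifferentiable (by simp) q)
    (smoothVField.mdifferentiableAt p.2.2 _) (smoothVField.mdifferentiableAt p'.2.2 _)
    (Filter.eventually_of_mem (hU.mem_nhds hq) hp) (Filter.eventually_of_mem (hU.mem_nhds hq) hp')
  rw [mlieBracket_prod] at h
  exact h

end smoothVField

end

/-! ### Differentiating the loop identities -/

namespace LocalAnalyticMoufangLoop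

section

open Topology

variable {E : Type*} [NormedAddCommGroup E] [NormedSpace ℝ E]
  {G : Type*} [TopologicalSpace G] [ChartedSpace E G] (Q : LocalAnalyticMoufangLoop E G)

/-- The differential of the multiplication. -/
noncomputable def dmul (q : G × G) : E × E →L[ℝ] E :=
  mfderiv (𝓘(ℝ, E).prod 𝓘(ℝ, E)) 𝓘(ℝ, E) (fun p : G × G => Q.mul p.1 p.2) q

/-- The differential of the inversion. -/
noncomputable def dinv (g : G) : E →L[ℝ] E := mfderiv 𝓘(ℝ, E) 𝓘(ℝ, E) Q.inv g

theorem inv_one : Q.inv Q.one = Q.one := by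
  have h := Q.inv_mul_cancel_left Q.one Q.one_mem Q.one (Q.one_left_mem _)
    (by rw [Q.one_mul]; exact Q.one_right_mem _)
  rwa [Q.mul_one, Q.mul_one] at h

theorem mdifferentiableAt_mul {q : G × G} (hq : q ∈ Q.dom) :
    MDifferentiableAt (𝓘(ℝ, E).prod 𝓘(ℝ, E)) 𝓘(ℝ, E) (fun p : G × G => Q.mul p.1 p.2) q :=
  (Q.contMDiffOn_mul.contMDiffAt (Q.isOpen_dom.mem_nhds hq)).mdifferentiableAt (by simp)

theorem hasMFDerivAt_inv {g : G} (hg : g ∈ Q.invDom) :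
    HasMFDerivAt 𝓘(ℝ, E) 𝓘(ℝ, E) Q.inv g (Q.dinv g) :=
  ((Q.contMDiffOn_inv.contMDiffAt (Q.isOpen_invDom.mem_nhds hg)).mdifferentiableAt
    (by simp)).hasMFDerivAt

section

variable {F H N : Type*} [NormedAddCommGroup F] [NormedSpace ℝ F] [TopologicalSpace H]
  {J : ModelWithCorners ℝ F H} [TopologicalSpace N] [ChartedSpace H N]

theorem hasMFDerivAt_mul {a b : N → G} {c : N} {g h : G} {a' b' : F →L[ℝ] E}
    (ha : HasMFDerivAt J 𝓘(ℝ, E) a c a') (hb : HasMFDerivAt J 𝓘(ℝ, E) b c b')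
    (hg : a c = g) (hh : b c = h) (hd : (g, h) ∈ Q.dom) :
    HasMFDerivAt J 𝓘(ℝ, E) (fun t => Q.mul (a t) (b t)) c
      ((Q.dmul (g, h)).comp (a'.prod b')) := by
  subst hg hh
  exact (Q.mdifferentiableAt_mul hd).hasMFDerivAt.comp c (ha.prodMk hb)

theorem hasMFDerivAt_inv_comp {a : N → G} {c : N} {g : G} {a' : F →L[ℝ] E}
    (ha : HasMFDerivAt J 𝓘(ℝ, E) a c a') (hg : a c = g) (hd : g ∈ Q.invDom) :
    HasMFDerivAt J 𝓘(ℝ, E) (fun t => Q.inv (a t)) c ((Q.dinv g).comp a') := by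
  subst hg
  exact (Q.hasMFDerivAt_inv hd).comp c ha

theorem hasMFDerivAt_eq {f f' : N → G} {c : N} {D D' : F →L[ℝ] E}
    (hf : HasMFDerivAt J 𝓘(ℝ, E) f c D) (hf' : HasMFDerivAt J 𝓘(ℝ, E) f' c D')
    (h : f =ᶠ[𝓝 c] f') : D = D' :=
  hasMFDerivAt_unique hf (hf'.congr_of_eventuallyEq h)

end

theorem eventually_mem_dom {N : Type*} [TopologicalSpace N] {a b : N → G} {c : N} {g h : G}
    (ha : ContinuousAt a c) (hb : ContinuousAt b c) (hg : a c = g) (hh : b c = h)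
    (hd : (g, h) ∈ Q.dom) : ∀ᶠ t in 𝓝 c, (a t, b t) ∈ Q.dom :=
  (ha.prodMk hb).preimage_mem_nhds (Q.isOpen_dom.mem_nhds (by rwa [hg, hh]))

/-- The infinitesimal left translations at `g`. -/
noncomputable def dleft (g : G) : E →L[ℝ] E :=
  (Q.dmul (Q.one, g)).comp ((ContinuousLinearMap.id ℝ E).prod 0)

/-- The infinitesimal right translations at `g`. -/
noncomputable def dright (g : G) : E →L[ℝ] E :=
  (Q.dmul (g, Q.one)).comp ((0 : E →L[ℝ] E).prod (ContinuousLinearMap.id ℝ E))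

theorem hasMFDerivAt_mul_left (g : G) :
    HasMFDerivAt 𝓘(ℝ, E) 𝓘(ℝ, E) (fun a => Q.mul a g) Q.one (Q.dleft g) :=
  Q.hasMFDerivAt_mul (hasMFDerivAt_id Q.one) (hasMFDerivAt_const g Q.one) rfl rfl
    (Q.one_left_mem g)

theorem hasMFDerivAt_mul_right (g : G) :
    HasMFDerivAt 𝓘(ℝ, E) 𝓘(ℝ, E) (fun a => Q.mul g a) Q.one (Q.dright g) :=
  Q.hasMFDerivAt_mul (hasMFDerivAt_const g Q.one) (hasMFDerivAt_id Q.one) rfl rfl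
    (Q.one_right_mem g)

theorem L_apply (x : Q.Tangent) (g : G) : Q.L x g = Q.dleft g x :=
  DFunLike.congr_fun (Q.hasMFDerivAt_mul_left g).mfderiv x

theorem R_apply (x : Q.Tangent) (g : G) : Q.R x g = Q.dright g x :=
  DFunLike.congr_fun (Q.hasMFDerivAt_mul_right g).mfderiv x

/-- By linearity the differential splits into its two partials, and the partial in the second factor
comes from `eg = g`. -/
theorem dmul_one_left (g : G) (x v : E) : Q.dmul (Q.one, g) (x, v) = Q.dleft g x + v := by
  have h := hasMFDerivAt_eq (Q.hasMFDerivAt_mul (hasMFDerivAt_const Q.one g) (hasMFDerivAt_id g)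
    rfl rfl (Q.one_left_mem g)) (hasMFDerivAt_id g) (.of_forall Q.one_mul)
  have hv : Q.dmul (Q.one, g) (0, v) = v := DFunLike.congr_fun h v
  have := map_add (Q.dmul (Q.one, g)) (x, 0) (0, v)
  rw [hv, Prod.mk_add_mk, add_zero, zero_add] at this
  exact this

theorem dmul_one_right (g : G) (v x : E) : Q.dmul (g, Q.one) (v, x) = v + Q.dright g x := by
  have h := hasMFDerivAt_eq (Q.hasMFDerivAt_mul (hasMFDerivAt_id g) (hasMFDerivAt_const Q.one g)
    rfl rfl (Q.one_right_mem g)) (hasMFDerivAt_id g) (.of_forall Q.mul_one)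
  have hv : Q.dmul (g, Q.one) (v, 0) = v := DFunLike.congr_fun h v
  have := map_add (Q.dmul (g, Q.one)) (v, 0) (0, x)
  rw [hv, Prod.mk_add_mk, add_zero, zero_add] at this
  exact this

theorem dleft_one (x : E) : Q.dleft Q.one x = x := by
  have := Q.dmul_one_right Q.one x 0
  rwa [map_zero, add_zero, dmul_one_left, add_zero] at this

theorem dright_one (x : E) : Q.dright Q.one x = x := by
  have := Q.dmul_one_left Q.one 0 x
  rwa [map_zero, zero_add, dmul_one_right, zero_add] at this

/-- The infinitesimal form of the identity `(ag)(ha) = (a(gh))a`. -/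
theorem dmul_dleft_dright {g h : G} (hd : (g, h) ∈ Q.dom) (x : E) :
    Q.dmul (g, h) (Q.dleft g x, Q.dright h x) =
      Q.dleft (Q.mul g h) x + Q.dright (Q.mul g h) x := by
  have e1 := Q.hasMFDerivAt_mul (Q.hasMFDerivAt_mul_left g) (Q.hasMFDerivAt_mul_right h)
    (Q.one_mul g) (Q.mul_one h) hd
  have e2 := Q.hasMFDerivAt_mul (Q.hasMFDerivAt_mul_left (Q.mul g h)) (hasMFDerivAt_id Q.one)
    (Q.one_mul _) rfl (Q.one_right_mem (Q.mul g h))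
  have h3 := DFunLike.congr_fun (hasMFDerivAt_eq e1 e2 ?_) x
  · exact h3.trans (Q.dmul_one_right _ _ _)
  · have hid : ContinuousAt (fun a : G => a) Q.one := continuousAt_id
    have hL (k : G) := (Q.hasMFDerivAt_mul_left k).continuousAt
    have hR (k : G) := (Q.hasMFDerivAt_mul_right k).continuousAt
    filter_upwards [Q.eventually_mem_dom hid continuousAt_const rfl rfl (Q.one_left_mem g),
      Q.eventually_mem_dom continuousAt_const hid rfl rfl (Q.one_right_mem h),
      Q.eventually_mem_dom (hL g) (hR h) (Q.one_mul g) (Q.mul_one h) hd,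
      Q.eventually_mem_dom hid continuousAt_const rfl rfl (Q.one_left_mem (Q.mul g h)),
      Q.eventually_mem_dom (hL (Q.mul g h)) hid (Q.one_mul _) rfl (Q.one_right_mem _)]
      with a h1 h2 h3 h4 h5
    exact Q.moufang a g h h1 h2 h3 hd h4 h5

theorem dinv_one (x : E) : Q.dinv Q.one x = -x := by
  have e1 := Q.hasMFDerivAt_mul (Q.hasMFDerivAt_inv Q.one_mem) (hasMFDerivAt_id Q.one)
    Q.inv_one rfl (Q.one_left_mem Q.one)
  have h := DFunLike.congr_fun (hasMFDerivAt_eq e1 (hasMFDerivAt_const Q.one Q.one) ?_) x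
  · refine eq_neg_of_add_eq_zero_left (Eq.trans ?_ h)
    exact ((Q.dmul_one_left _ _ _).trans (congrArg (· + x) (Q.dleft_one _))).symm
  · have hid : ContinuousAt (fun a : G => a) Q.one := continuousAt_id
    filter_upwards [Q.isOpen_invDom.mem_nhds Q.one_mem, Q.eventually_mem_dom
      (Q.hasMFDerivAt_inv Q.one_mem).continuousAt hid Q.inv_one rfl (Q.one_left_mem _)]
      with a h1 h2
    -- Cancellation at `h = e` supplies `a⁻¹a = e`, which is not an axiom of the local loop.
    have := Q.inv_mul_cancel_left a h1 Q.one (Q.one_right_mem a) (by rwa [Q.mul_one])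
    rwa [Q.mul_one] at this

theorem M_apply (x : Q.Tangent) (g : G) : Q.M x g = -(Q.L x g + Q.R x g) := by
  have hi := Q.hasMFDerivAt_inv Q.one_mem
  have e := Q.hasMFDerivAt_mul hi (Q.hasMFDerivAt_mul (hasMFDerivAt_const g Q.one) hi rfl
    Q.inv_one (Q.one_right_mem g)) Q.inv_one (by rw [Q.inv_one, Q.mul_one]) (Q.one_left_mem g)
  have hM (v : E) : Q.dmul (Q.one, g) (Q.dinv Q.one v, Q.dmul (g, Q.one) (0, Q.dinv Q.one v)) =
      -(Q.dleft g v + Q.dright g v) := by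
    rw [dinv_one, dmul_one_left, dmul_one_right, zero_add, map_neg, map_neg, ← neg_add]
  rw [L_apply, R_apply]
  exact (DFunLike.congr_fun e.mfderiv x).trans (hM x)

/-- This is the derivative at `a = e` of `(ga)⁻¹ = a⁻¹g⁻¹`. -/
theorem dinv_dright {g : G} (hg : g ∈ Q.invDom) (hd : (Q.inv g, g) ∈ Q.dom) (x : E) :
    Q.dinv g (Q.dright g x) = -Q.dleft (Q.inv g) x := by
  have hi := Q.hasMFDerivAt_inv Q.one_mem
  have hR := Q.hasMFDerivAt_mul_right g
  have e1 := Q.hasMFDerivAt_inv_comp hR (Q.mul_one g) hg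
  have e2 := Q.hasMFDerivAt_mul hi (hasMFDerivAt_const (Q.inv g) Q.one) Q.inv_one rfl
    (Q.one_left_mem (Q.inv g))
  have h := DFunLike.congr_fun (hasMFDerivAt_eq e1 e2 ?_) x
  · refine h.trans ?_
    change Q.dmul (Q.one, Q.inv g) (Q.dinv Q.one x, 0) = _
    rw [dinv_one, dmul_one_left, add_zero, map_neg]
  · have hid : ContinuousAt (fun a : G => a) Q.one := continuousAt_id
    filter_upwards [Q.isOpen_invDom.mem_nhds Q.one_mem,
      hR.continuousAt.preimage_mem_nhds (Q.isOpen_invDom.mem_nhds (by rwa [Q.mul_one])),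
      Q.eventually_mem_dom continuousAt_const hid rfl rfl (Q.one_right_mem g),
      Q.eventually_mem_dom hR.continuousAt hi.continuousAt (Q.mul_one g) Q.inv_one
        (Q.one_right_mem g),
      Q.eventually_mem_dom e1.continuousAt continuousAt_const
        (congrArg Q.inv (Q.mul_one g)) rfl hd,
      Q.eventually_mem_dom hi.continuousAt continuousAt_const Q.inv_one rfl
        (Q.one_left_mem (Q.inv g))] with a h1 h2 h3 h4 h5 h6
    -- From `(ga)a⁻¹ = g` follows `(ga)⁻¹g = a⁻¹`, and cancelling `g` on the right gives `(ga)⁻¹ =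
    -- a⁻¹g⁻¹`.
    have s1 := Q.mul_inv_cancel_right a h1 g h3 h4
    have s2 := Q.inv_mul_cancel_left (Q.mul g a) h2 (Q.inv a) h4 (by rwa [s1])
    rw [s1] at s2
    have s3 := Q.mul_inv_cancel_right g hg (Q.inv (Q.mul g a)) h5 (by rwa [s2])
    rw [s2] at s3
    exact s3.symm

/-- The pairs `(g, h)` such that `gh`, `g⁻¹(gh)` and `g⁻¹g` are defined. -/
def leftInvDom : Set (G × G) :=
  {q | q ∈ Q.dom ∧ q.1 ∈ Q.invDom ∧ (Q.inv q.1, Q.mul q.1 q.2) ∈ Q.dom ∧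
    (Q.inv q.1, q.1) ∈ Q.dom}

theorem one_left_mem_leftInvDom (g : G) : (Q.one, g) ∈ Q.leftInvDom := by
  refine ⟨Q.one_left_mem g, Q.one_mem, ?_, ?_⟩
  · rw [Q.inv_one]; exact Q.one_left_mem _
  · rw [Q.inv_one]; exact Q.one_left_mem _

theorem isOpen_leftInvDom : IsOpen Q.leftInvDom := by
  refine isOpen_iff_mem_nhds.2 fun q ⟨h1, h2, h3, h4⟩ => ?_
  have hi : ContinuousAt (fun p : G × G => Q.inv p.1) q :=
    (Q.hasMFDerivAt_inv h2).continuousAt.comp continuousAt_fst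
  filter_upwards [Q.isOpen_dom.mem_nhds h1,
    continuousAt_fst.preimage_mem_nhds (Q.isOpen_invDom.mem_nhds h2),
    Q.eventually_mem_dom hi (Q.mdifferentiableAt_mul h1).continuousAt rfl rfl h3,
    Q.eventually_mem_dom hi continuousAt_fst rfl rfl h4] with p h1 h2 h3 h4 using ⟨h1, h2, h3, h4⟩

theorem dmul_dinv_dmul {g h : G} (hd : (g, h) ∈ Q.leftInvDom) (v w : E) :
    Q.dmul (Q.inv g, Q.mul g h) (Q.dinv g v, Q.dmul (g, h) (v, w)) = w := by
  obtain ⟨h1, h2, h3, h4⟩ := hd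
  have e := Q.hasMFDerivAt_mul (c := (g, h)) (Q.hasMFDerivAt_inv_comp
    (hasMFDerivAt_fst (g, h)) rfl h2) (Q.mdifferentiableAt_mul h1).hasMFDerivAt rfl rfl h3
  refine DFunLike.congr_fun (hasMFDerivAt_eq e (hasMFDerivAt_snd (g, h)) ?_) (v, w)
  filter_upwards [Q.isOpen_leftInvDom.mem_nhds ⟨h1, h2, h3, h4⟩] with q ⟨h1, h2, h3, h4⟩
  exact Q.inv_mul_cancel_left q.1 h2 q.2 h1 h3

/-- The infinitesimal form of the identity `(ga⁻¹)((ah)a) = (gh)a`. -/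
theorem dmul_neg_dright [FiniteDimensional ℝ E] {g h : G} (hd : (g, h) ∈ Q.leftInvDom) (x : E) :
    Q.dmul (g, h) (-Q.dright g x, Q.dleft h x + Q.dright h x) = Q.dright (Q.mul g h) x := by
  -- The Moufang identity is used at the pair `(g⁻¹, gh)`, whose product is `h`; `h2` differentiates
  -- `g⁻¹(gh) = h`.
  have h1 := Q.dmul_dleft_dright hd.2.2.1 x
  have h2 := Q.dmul_dinv_dmul hd (-Q.dright g x) (Q.dleft h x + Q.dright h x)
  rw [Q.inv_mul_cancel_left g hd.2.1 h hd.1 hd.2.2.1] at h1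
  rw [map_neg, Q.dinv_dright hd.2.1 hd.2.2.2, neg_neg] at h2
  -- `B` is the differential of left translation by `g⁻¹` at `gh`. It is onto because `g⁻¹(gh) = h`,
  -- hence injective in finite dimension, so it can be cancelled when `h1` and `h2` are compared.
  let B : E →ₗ[ℝ] E := (Q.dmul (Q.inv g, Q.mul g h)).toLinearMap.comp (LinearMap.inr ℝ E E)
  have hB : Function.Surjective B := fun w => ⟨Q.dmul (g, h) (0, w), by
    have := Q.dmul_dinv_dmul hd 0 w
    rwa [map_zero] at this⟩
  refine sub_eq_zero.1 ((injective_iff_map_eq_zero B).1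
    (LinearMap.injective_iff_surjective.2 hB) _ ?_)
  rw [← sub_eq_zero.2 (h2.trans h1.symm), ← map_sub, Prod.mk_sub_mk, sub_self]
  rfl

end

/-! ### Infinitesimal translations as smooth fields -/

section

variable {E : Type*} [NormedAddCommGroup E] [NormedSpace ℝ E]
  {G : Type*} [TopologicalSpace G] [ChartedSpace E G] [IsManifold 𝓘(ℝ, E) ω G]
  (Q : LocalAnalyticMoufangLoop E G)

open Bundle

/-- The derivative of the multiplication along a smooth curve of tangent vectors is smooth. -/
theorem contMDiff_dmul (F : G → TangentBundle (𝓘(ℝ, E).prod 𝓘(ℝ, E)) (G × G))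
    (hF : ContMDiff 𝓘(ℝ, E) (𝓘(ℝ, E).prod 𝓘(ℝ, E)).tangent ∞ F)
    (hd : ∀ g, (F g).proj ∈ Q.dom) :
    ContMDiff 𝓘(ℝ, E) 𝓘(ℝ, E).tangent ∞ fun g =>
      tangentMap (𝓘(ℝ, E).prod 𝓘(ℝ, E)) 𝓘(ℝ, E) (fun p : G × G => Q.mul p.1 p.2) (F g) := by
  have h1 : ContMDiffOn (𝓘(ℝ, E).prod 𝓘(ℝ, E)).tangent 𝓘(ℝ, E).tangent ∞
      (tangentMapWithin (𝓘(ℝ, E).prod 𝓘(ℝ, E)) 𝓘(ℝ, E) (fun p : G × G => Q.mul p.1 p.2) Q.dom)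
      (TotalSpace.proj ⁻¹' Q.dom) :=
    Q.contMDiffOn_mul.contMDiffOn_tangentMapWithin le_top Q.isOpen_dom.uniqueMDiffOn
  have h2 := h1.comp_contMDiff hF hd
  refine h2.congr fun g => ?_
  exact (tangentMapWithin_eq_tangentMap (Q.isOpen_dom.uniqueMDiffWithinAt (hd g))
    (Q.mdifferentiableAt_mul (hd g))).symm

theorem L_mem (x : Q.Tangent) : Q.L x ∈ smoothVField E G := by
  have hc : ContMDiff 𝓘(ℝ, E) 𝓘(ℝ, E).tangent ∞
    fun _ : G => (⟨Q.one, x⟩ : TangentBundle 𝓘(ℝ, E) G) := contMDiff_const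
  have h := Q.contMDiff_dmul _ (contMDiff_equivTangentBundleProd_symm.comp
    (hc.prodMk (contMDiff_zeroSection ℝ (TangentSpace 𝓘(ℝ, E) (M := G))))) Q.one_left_mem
  refine h.congr fun g => ?_
  refine TotalSpace.ext (Q.one_mul g).symm (heq_of_eq ?_)
  exact Q.L_apply x g

theorem R_mem (x : Q.Tangent) : Q.R x ∈ smoothVField E G := by
  have hc : ContMDiff 𝓘(ℝ, E) 𝓘(ℝ, E).tangent ∞
    fun _ : G => (⟨Q.one, x⟩ : TangentBundle 𝓘(ℝ, E) G) := contMDiff_const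
  have h := Q.contMDiff_dmul _ (contMDiff_equivTangentBundleProd_symm.comp
    ((contMDiff_zeroSection ℝ (TangentSpace 𝓘(ℝ, E) (M := G))).prodMk hc)) Q.one_right_mem
  refine h.congr fun g => ?_
  refine TotalSpace.ext (Q.mul_one g).symm (heq_of_eq ?_)
  exact Q.R_apply x g

/-- The map `x ↦ L_x` into the smooth vector fields. -/
noncomputable def smoothL : Q.Tangent →ₗ[ℝ] smoothVField E G := Q.L.codRestrict _ Q.L_mem

/-- The map `x ↦ R_x` into the smooth vector fields. -/
noncomputable def smoothR : Q.Tangent →ₗ[ℝ] smoothVField E G := Q.R.codRestrict _ Q.R_mem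

/-- Evaluation of vector fields at the unit. -/
noncomputable def evalOne : smoothVField E G →ₗ[ℝ] Q.Tangent where
  toFun X := X.1 Q.one
  map_add' _ _ := rfl
  map_smul' _ _ := rfl

omit [IsManifold 𝓘(ℝ, E) ω G] in
theorem M_eq : Q.M = -(Q.L + Q.R) := LinearMap.ext fun x => funext fun g => Q.M_apply x g

/-- Two domains are needed: the right triples use inversion, defined only near `e`, so they live on
a neighbourhood of `{e} × G`, whereas the rule `C = A + R_{B(e)}` requires all of `G × {e}`. -/
theorem infinitesimalMoufang [FiniteDimensional ℝ E] :
    have := FiniteDimensional.complete ℝ E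
    InfinitesimalMoufang Q.smoothL Q.smoothR Q.evalOne
      (smoothVField.autotopism (fun p => Q.mul p.1 p.2) Q.dom)
      (smoothVField.autotopism (fun p => Q.mul p.1 p.2) Q.leftInvDom) := by
  have := FiniteDimensional.complete ℝ E
  have hm : ContMDiffOn (𝓘(ℝ, E).prod 𝓘(ℝ, E)) 𝓘(ℝ, E) 2
    (fun p : G × G => Q.mul p.1 p.2) Q.dom := Q.contMDiffOn_mul.of_le le_top
  have hmiddle (x : Q.Tangent) (q : G × G) (hq : q ∈ Q.dom) :
      Q.dmul q (Q.L x q.1, Q.R x q.2) = (Q.L x (Q.mul q.1 q.2) + Q.R x (Q.mul q.1 q.2) : E) := by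
    have := Q.dmul_dleft_dright hq x
    rw [L_apply, R_apply, L_apply, R_apply]
    exact this
  have hleft (p : smoothVField E G × smoothVField E G × smoothVField E G)
      (hp : ∀ g, Q.dmul (Q.one, g) (p.1.1 Q.one, p.2.1.1 g) = p.2.2.1 (Q.mul Q.one g)) :
      p.2.2 = p.2.1 + Q.smoothL (Q.evalOne p.1) := by
    ext g
    have h1 : (p.2.2.1 g : E) = p.2.2.1 (Q.mul Q.one g) := by rw [Q.one_mul]
    refine h1.trans ((hp g).symm.trans ((Q.dmul_one_left _ _ _).trans ((add_comm _ _).trans ?_)))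
    exact congrArg (p.2.1.1 g + ·) (Q.L_apply _ _).symm
  constructor
  · exact fun x => (Q.L_apply x _).trans (Q.dleft_one x)
  · exact fun x => (Q.R_apply x _).trans (Q.dright_one x)
  · exact fun p hp q hq => smoothVField.lie_mem_autotopism Q.isOpen_dom hm hp hq
  · exact fun p hp q hq => smoothVField.lie_mem_autotopism Q.isOpen_leftInvDom
      (hm.mono fun q hq => hq.1) hp hq
  · exact hmiddle
  · exact fun x q hq => hmiddle x q hq.1
  · intro x q hq
    have := Q.dmul_neg_dright hq x
    refine Eq.trans (congrArg (Q.dmul q) (Prod.ext ?_ ?_)) (this.trans (Q.R_apply _ _).symm)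
    · exact congrArg Neg.neg (Q.R_apply x q.1)
    · exact congrArg₂ (· + ·) (Q.L_apply x q.2) (Q.R_apply x q.2)
  · intro p hp
    ext g
    have h1 : (p.2.2.1 g : E) = p.2.2.1 (Q.mul g Q.one) := by rw [Q.mul_one]
    refine h1.trans ((hp _ (Q.one_right_mem g)).symm.trans ((Q.dmul_one_right _ _ _).trans ?_))
    exact congrArg (p.1.1 g + ·) (Q.R_apply _ _).symm
  · exact fun p hp => hleft p fun g => hp _ (Q.one_left_mem g)
  · exact fun p hp => hleft p fun g => hp _ (Q.one_left_mem_leftInvDom g)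

end

end LocalAnalyticMoufangLoop

/-! ### Loos bracket and the main theorem -/

namespace LocalAnalyticMoufangLoop

variable {E : Type*} [NormedAddCommGroup E] [NormedSpace ℝ E] [FiniteDimensional ℝ E]
  {G : Type*} [TopologicalSpace G] [ChartedSpace E G] [IsManifold 𝓘(ℝ, E) ω G]
  (Q : LocalAnalyticMoufangLoop E G)

theorem loos_eq (x y z : Q.Tangent) :
    Q.loos x y z = mlieBracket 𝓘(ℝ, E) (mlieBracket 𝓘(ℝ, E) (Q.R x) (Q.R y)) (Q.R z) Q.one := by
  have := FiniteDimensional.complete ℝ E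
  have h : (3 : ℝ) • mlieBracket 𝓘(ℝ, E) (mlieBracket 𝓘(ℝ, E) (Q.R x) (Q.R y)) (Q.R z) Q.one =
      Q.bracket x (Q.bracket y z) - Q.bracket y (Q.bracket x z) +
      (2 : ℝ) • Q.bracket (Q.bracket x y) z :=
    Q.infinitesimalMoufang.three_smul_ev_lie_lie_right x y z
  rw [loos, yamaguti, inv_smul_eq_iff₀ (by norm_num), h]
  module

theorem mlieBracket_double {T : Q.Tangent →ₗ[ℝ] VField E G} (hT : T = Q.L ∨ T = Q.R ∨ T = Q.M)
    (x y z : Q.Tangent) :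
    mlieBracket 𝓘(ℝ, E) (Q.double T x y) (T z) = T (Q.loos x y z) := by
  have := FiniteDimensional.complete ℝ E
  rw [loos_eq]
  rcases hT with rfl | rfl | rfl
  · exact congrArg Subtype.val (Q.infinitesimalMoufang.lie_lie (.inl rfl) x y z)
  · exact congrArg Subtype.val (Q.infinitesimalMoufang.lie_lie (.inr (.inl rfl)) x y z)
  · rw [M_eq]
    exact congrArg Subtype.val (Q.infinitesimalMoufang.lie_lie (.inr (.inr rfl)) x y z)

omit [FiniteDimensional ℝ E] in
theorem mem_smoothVField {T : Q.Tangent →ₗ[ℝ] VField E G} (hT : T = Q.L ∨ T = Q.R ∨ T = Q.M)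
    (x : Q.Tangent) : T x ∈ smoothVField E G := by
  rcases hT with rfl | rfl | rfl
  · exact Q.L_mem x
  · exact Q.R_mem x
  · rw [M_eq]
    exact neg_mem (add_mem (Q.L_mem x) (Q.R_mem x))

end LocalAnalyticMoufangLoop

theorem mainTheorem2 {E : Type*} [NormedAddCommGroup E] [NormedSpace ℝ E] [FiniteDimensional ℝ E]
    {G : Type*} [TopologicalSpace G] [ChartedSpace E G] [IsManifold 𝓘(ℝ, E) ω G]
    (Q : LocalAnalyticMoufangLoop E G)
    (T : Q.Tangent →ₗ[ℝ] VField E G) (hT : T = Q.L ∨ T = Q.R ∨ T = Q.M) :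
    (∀ x y z : Q.Tangent,
      mlieBracket 𝓘(ℝ, E) (Q.double T x y) (T z) = T (Q.loos x y z)) ∧
    (∀ x y z w : Q.Tangent,
      mlieBracket 𝓘(ℝ, E) (Q.double T x y) (Q.double T z w) =
        Q.double T (Q.loos x y z) w + Q.double T z (Q.loos x y w)) ∧
    (let 𝔪 : Submodule ℝ (VField E G) := LinearMap.range T
     let 𝔥 : Submodule ℝ (VField E G) := VField.bracketSpan 𝔪 𝔪
     VField.bracketSpan 𝔥 𝔪 ≤ 𝔪 ∧ VField.bracketSpan 𝔥 𝔥 ≤ 𝔥 ∧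
       VField.bracketSpan (𝔪 ⊔ 𝔥) (𝔪 ⊔ 𝔥) ≤ 𝔪 ⊔ 𝔥) := by
  have := FiniteDimensional.complete ℝ E
  let S : Q.Tangent →ₗ[ℝ] smoothVField E G := T.codRestrict _ (Q.mem_smoothVField hT)
  have h1 : ∀ x y z : Q.Tangent, ⁅⁅S x, S y⁆, S z⁆ = S (Q.loos x y z) := fun x y z =>
    Subtype.ext (Q.mlieBracket_double hT x y z)
  refine ⟨Q.mlieBracket_double hT, fun x y z w => ?_, ?_⟩
  · have h2 : ⁅⁅S x, S y⁆, ⁅S z, S w⁆⁆ = ⁅S (Q.loos x y z), S w⁆ + ⁅S z, S (Q.loos x y w)⁆ := by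
      rw [leibniz_lie, h1, h1]
    exact congrArg Subtype.val h2
  · have hA : ∀ a ∈ LinearMap.range S, ∀ b ∈ LinearMap.range S, ∀ c ∈ LinearMap.range S,
        ⁅⁅a, b⁆, c⁆ ∈ LinearMap.range S := by
      rintro _ ⟨x, rfl⟩ _ ⟨y, rfl⟩ _ ⟨z, rfl⟩
      exact ⟨_, (h1 x y z).symm⟩
    have hr : LinearMap.range T = (LinearMap.range S).map (smoothVField E G).subtype := by
      rw [← LinearMap.range_comp]
      rfl
    intro 𝔪 𝔥
    have hm : 𝔪 = (LinearMap.range S).map (smoothVField E G).subtype := hr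
    have hh : 𝔥 = (Submodule.lieSpan (LinearMap.range S) (LinearMap.range S)).map
        (smoothVField E G).subtype := by
      rw [smoothVField.map_lieSpan, ← hm]
    rw [hh, hm, ← Submodule.map_sup]
    simp only [← smoothVField.map_lieSpan]
    exact ⟨Submodule.map_mono (Submodule.lieSpan_lieSpan_self_le hA),
      Submodule.map_mono (Submodule.lieSpan_lieSpan_lieSpan_le hA),
      Submodule.map_mono (Submodule.lieSpan_sup_le hA)⟩
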